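/- Let $M \subseteq \mathbb{R}^D$ be a nonempty closed (for example, compact) smooth embedded $d$-dimensional submanifold without boundary, with the Riemannian metric induced by $\mathbb{R}^D$. For $r \ge 0$ let $N_r = \{(p,v) : p \in M,\ v \perp T_pM,\ \|v\| < r\}$ be its open normal bundle of radius $r$. The condition number (reach) of $M$ is the largest $\tau \in [0,\infty]$ such that for every $r < \tau$ the map $(p,v) \mapsto p+v$ is an embedding of $N_r$ into $\mathbb{R}^D$. Let $\tau \in [0,\infty)$ be the condition number of $M$ or, more generally, any real number in $[0,\infty)$ not exceeding it, let $0 \le \varepsilon \le \frac14$, and let $S \subset M$ be a finite set. Then $S$ has local covariance dimension $\left(d, \varepsilon, \frac{\sqrt{\varepsilon}\,\tau}{3}\right)$. That is, for every closed ball $B \subset \mathbb{R}^D$ of radius $\frac{\sqrt{\varepsilon}\,\tau}{3}$ there is an isometry of $\mathbb{R}^D$ such that, for the covariance matrix of the image of $A = S \cap B$ under it, some $d$ diagonal entries have sum at least $(1-\varepsilon)$ times the trace (the covariance matrix of the empty set is read as $0$). Moreover, the $d$ directions can be taken tangent to $M$: if $A \neq \emptyset$ and $\mu$ is the mean of $A$,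 then there is a point of $M$ nearest to $\mu$, and for every such nearest point $q$ the tangent space $T_qM$ is a $d$-dimensional linear subspace of $\mathbb{R}^D$ with $$\sum_{x \in A} \|P_{T_qM}(x-\mu)\|^2 \;\ge\; (1-\varepsilon) \sum_{x \in A} \|x-\mu\|^2,$$ where $P_{T_qM}$ is the orthogonal projection onto $T_qM$. -/

import Mathlib

open scoped Manifold ContDiff NNReal ENNReal

attribute [-instance] TopCat.of.chartedSpace

noncomputable section

/-! ### Finite data sets, covariance, local covariance dimension -/

/-- The mean of a finite data set. -/
def dataMean {D : ℕ} (S : Finset (EuclideanSpace ℝ (Fin D))) : EuclideanSpace ℝ (Fin D) :=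
  (S.card : ℝ)⁻¹ • ∑ x ∈ S, x

/-- The covariance matrix of a finite data set (uniform weights). -/
def dataCovariance {D : ℕ} (S : Finset (EuclideanSpace ℝ (Fin D))) :
    Matrix (Fin D) (Fin D) ℝ :=
  Matrix.of fun i j =>
    (S.card : ℝ)⁻¹ * ∑ x ∈ S, (x i - dataMean S i) * (x j - dataMean S j)

open Classical in
/-- The restriction of a data set to the closed ball `B(c, r)`. -/
def restrictToBall {D : ℕ} (S : Finset (EuclideanSpace ℝ (Fin D)))
    (c : EuclideanSpace ℝ (Fin D)) (r : ℝ) : Finset (EuclideanSpace ℝ (Fin D)) :=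
  S.filter fun x => x ∈ Metric.closedBall c r

/-- There is an isometry of `ℝ^D` under which the covariance matrix of `S` has some `d` diagonal
entries that contribute a `(1 - ε)` fraction of its trace. -/
def HasCovarianceDimension {D : ℕ} (S : Finset (EuclideanSpace ℝ (Fin D))) (d : ℕ) (ε : ℝ) :
    Prop :=
  ∃ (Φ : EuclideanSpace ℝ (Fin D) ≃ᵢ EuclideanSpace ℝ (Fin D)) (J : Finset (Fin D)),
    J.card = d ∧
      (1 - ε) * (dataCovariance (S.map Φ.toEquiv.toEmbedding)).trace ≤
        ∑ i ∈ J, dataCovariance (S.map Φ.toEquiv.toEmbedding) i i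

/-- `S` has local covariance dimension `(d, ε, r)`: its restriction to any ball of radius `r` has
covariance dimension `(d, ε)`. The isometry may depend on the ball. -/
def HasLocalCovarianceDimension {D : ℕ} (S : Finset (EuclideanSpace ℝ (Fin D)))
    (d : ℕ) (ε r : ℝ) : Prop :=
  ∀ c : EuclideanSpace ℝ (Fin D), HasCovarianceDimension (restrictToBall S c r) d ε

/-! ### Submanifolds of `ℝ^D` and their condition number -/

section Submanifold

variable {d D : ℕ} (M : Set (EuclideanSpace ℝ (Fin D))) [ChartedSpace (EuclideanSpace ℝ (Fin d)) M]

/-- `M`, with the given charts and the subspace topology, is a smooth embedded `d`-dimensional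
submanifold of `ℝ^D`, without boundary. It carries the Riemannian metric induced by `ℝ^D`. -/
def IsSmoothSubmanifold : Prop :=
  IsManifold (𝓡 d) ∞ M ∧
    Manifold.IsSmoothEmbedding (𝓡 d) (𝓡 D) ∞ (Subtype.val : M → EuclideanSpace ℝ (Fin D))

/-- The tangent space of `M` at `p`, as a linear subspace of `ℝ^D`. -/
def tangentSubspace (p : M) : Submodule ℝ (EuclideanSpace ℝ (Fin D)) :=
  LinearMap.range
    (mfderiv (𝓡 d) (𝓡 D) (Subtype.val : M → EuclideanSpace ℝ (Fin D)) p :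
      EuclideanSpace ℝ (Fin d) →L[ℝ] EuclideanSpace ℝ (Fin D)).toLinearMap

/-- The open normal bundle of radius `r`: pairs `(p, v)` with `p ∈ M`, `v` normal to `M` at `p`
and `‖v‖ < r`. -/
def openNormalBundle (r : ℝ) : Set (M × EuclideanSpace ℝ (Fin D)) :=
  {z | z.2 ∈ (tangentSubspace (d := d) M z.1)ᗮ ∧ ‖z.2‖ < r}

/-- The endpoint map `(p, v) ↦ p + v`. -/
def endpointMap (z : M × EuclideanSpace ℝ (Fin D)) : EuclideanSpace ℝ (Fin D) :=
  (z.1 : EuclideanSpace ℝ (Fin D)) + z.2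

/-- The open normal bundle of radius `r`, a manifold of dimension `D`, is embedded in `ℝ^D` by the
endpoint map: the map is a diffeomorphism onto an open set. Its inverse is `y ↦ (π y, y - π y)`,
so the smoothness of the inverse is that of the foot point map `π`. -/
def NormalBundleEmbedded (r : ℝ) : Prop :=
  Set.InjOn (endpointMap M) (openNormalBundle (d := d) M r) ∧
    IsOpen (endpointMap M '' openNormalBundle (d := d) M r) ∧
    ∃ π : EuclideanSpace ℝ (Fin D) → M,
      (∀ z ∈ openNormalBundle (d := d) M r, π (endpointMap M z) = z.1) ∧
      ContMDiffOn (𝓡 D) (𝓡 d) ∞ π (endpointMap M '' openNormalBundle (d := d) M r)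

/-- The condition number `τ` of `M`: the largest `τ ∈ [0, ∞]` such that the open normal bundle of
radius `r` is embedded in `ℝ^D` for every `r < τ`. -/
def conditionNumber : ℝ≥0∞ :=
  sSup {τ : ℝ≥0∞ | ∀ r : ℝ≥0, (r : ℝ≥0∞) < τ → NormalBundleEmbedded (d := d) M r}

end Submanifold

end

/-! Let `m` be the mean of `A` and `p` a point of `M` nearest to `m`. Every `x ∈ A` lies in `M`, so
`‖m - p‖ ≤ ‖x - m‖`. Two consequences follow. With `r = √ε τ / 3`, `‖x - p‖ ≤ 2‖x - m‖ ≤ 4r`; and by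
Steiner's identity the second moment of `A` about `p` is at most twice that about `m`. Federer's
estimate bounds the component of `x - p` normal to `M` at `p` by `‖x - p‖² / (2τ)`, hence by
`(2√ε/3)‖x - p‖`. Squaring and summing, the normal variance is at most `(4ε/9) · 2 = 8ε/9` times the
total variance, and the tangential part keeps the rest. Federer's estimate holds because a ball of
radius `t < τ` tangent to `M` at `p` has no point of `M` in its interior: otherwise its centre would
be the endpoint of two short normal vectors. -/

open Manifold in
/-- The differential of an immersion into a Euclidean space is injective. -/
theorem Manifold.IsImmersionAt.injective_mfderiv_euclidean {d D : ℕ} {M : Type*}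
    [TopologicalSpace M] [ChartedSpace (EuclideanSpace ℝ (Fin d)) M] [IsManifold (𝓡 d) ∞ M]
    {f : M → EuclideanSpace ℝ (Fin D)} {x : M} (h : IsImmersionAt (𝓡 d) (𝓡 D) ∞ f x) :
    Function.Injective (mfderiv (𝓡 d) (𝓡 D) f x) := by
  have hf : MDifferentiableAt (𝓡 d) (𝓡 D) f x := h.contMDiffAt.mdifferentiableAt (by simp)
  have hφ : h.domChart.MDifferentiable (𝓡 d) (𝓡 d) :=
    ⟨(contMDiffOn_of_mem_maximalAtlas h.domChart_mem_maximalAtlas).mdifferentiableOn (by simp),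
      (contMDiffOn_symm_of_mem_maximalAtlas h.domChart_mem_maximalAtlas).mdifferentiableOn
        (by simp)⟩
  have hψ : MDifferentiableAt (𝓡 D) (𝓡 D) h.codChart (f x) :=
    (contMDiffAt_of_mem_maximalAtlas h.codChart_mem_maximalAtlas
      h.mem_codChart_source).mdifferentiableAt (by simp)
  set L : EuclideanSpace ℝ (Fin d) →L[ℝ] EuclideanSpace ℝ (Fin D) :=
    h.equiv.toContinuousLinearMap ∘L ContinuousLinearMap.inl ℝ _ h.complement with hLdef
  have hLinj : Function.Injective L := by
    intro a b hab
    have := h.equiv.injective hab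
    simpa using this
  -- In the immersion charts `f` is the linear inclusion `u ↦ (u, 0)`, so injectivity reduces to
  -- that of `L` and of the chart's differential.
  have heq : h.codChart ∘ f =ᶠ[nhds x] L ∘ h.domChart := by
    filter_upwards [h.domChart.open_source.mem_nhds h.mem_domChart_source] with y hy
    have hw := h.writtenInCharts (show h.domChart y ∈ (h.domChart.extend (𝓡 d)).target by simpa using h.domChart.map_source hy)
    simpa [hLdef, h.domChart.left_inv hy] using hw
  have hφx := hφ.mdifferentiableAt h.mem_domChart_source
  have hL : MDifferentiableAt (𝓡 d) (𝓡 D) L (h.domChart x) :=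
    L.differentiableAt.mdifferentiableAt
  have hcomp : (mfderiv (𝓡 D) (𝓡 D) h.codChart (f x)).comp (mfderiv (𝓡 d) (𝓡 D) f x) =
      (mfderiv (𝓡 d) (𝓡 D) L (h.domChart x)).comp (mfderiv (𝓡 d) (𝓡 d) h.domChart x) := by
    rw [← mfderiv_comp x hψ hf, ← mfderiv_comp x hL hφx]
    exact heq.mfderiv_eq
  have hLd : mfderiv (𝓡 d) (𝓡 D) L (h.domChart x) = L := by
    rw [mfderiv_eq_fderiv]
    exact L.fderiv
  have hinj : Function.Injective ((mfderiv (𝓡 d) (𝓡 D) L (h.domChart x)).comp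
      (mfderiv (𝓡 d) (𝓡 d) h.domChart x)) := by
    rw [hLd]
    exact hLinj.comp (hφ.mfderiv_injective h.mem_domChart_source)
  rw [← hcomp] at hinj
  exact Function.Injective.of_comp hinj

/-! ### Nearest points, normal vectors and the condition number -/

section Submanifold

variable {d D : ℕ} {M : Set (EuclideanSpace ℝ (Fin D))}
  [ChartedSpace (EuclideanSpace ℝ (Fin d)) M]

theorem IsSmoothSubmanifold.finrank_tangentSubspace (hM : IsSmoothSubmanifold (d := d) M) (p : M) :
    Module.finrank ℝ (tangentSubspace (d := d) M p) = d := by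
  have := hM.1
  have hinj := (hM.2.isImmersion.isImmersionAt p).injective_mfderiv_euclidean
  have := LinearMap.finrank_range_of_inj
    (f := (mfderiv (𝓡 d) (𝓡 D) (Subtype.val : M → EuclideanSpace ℝ (Fin D)) p :
      EuclideanSpace ℝ (Fin d) →L[ℝ] EuclideanSpace ℝ (Fin D)).toLinearMap) hinj
  exact this.trans finrank_euclideanSpace_fin

/-- The segment from a point to a nearest point of a submanifold is normal to the submanifold. -/
theorem IsSmoothSubmanifold.sub_mem_orthogonal_tangentSubspace
    (hM : IsSmoothSubmanifold (d := d) M) {y : EuclideanSpace ℝ (Fin D)} {p : M}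
    (hp : ∀ q : M, dist y p ≤ dist y q) :
    y - p ∈ (tangentSubspace (d := d) M p)ᗮ := by
  have hdiff : MDifferentiableAt (𝓡 d) (𝓡 D) (Subtype.val : M → EuclideanSpace ℝ (Fin D)) p :=
    (hM.2.contMDiff p).mdifferentiableAt (by simp)
  have hd := hdiff.hasMFDerivAt.2
  set A : EuclideanSpace ℝ (Fin d) →L[ℝ] EuclideanSpace ℝ (Fin D) :=
    mfderiv (𝓡 d) (𝓡 D) (Subtype.val : M → EuclideanSpace ℝ (Fin D)) p with hA
  set z := extChartAt (𝓡 d) p p with hz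
  set g : EuclideanSpace ℝ (Fin d) → EuclideanSpace ℝ (Fin D) :=
    fun w => ((extChartAt (𝓡 d) p).symm w : M) with hg
  have hgd : HasFDerivAt g A z := by
    have : HasFDerivWithinAt g A (Set.range (𝓡 d)) z := hd
    simpa using this
  have hgz : g z = p := by simp [hg, hz]
  have hsq : HasFDerivAt (fun w => ‖y - g w‖ ^ 2)
      (2 • (innerSL ℝ (y - g z)).comp (-A)) z := (hgd.const_sub y).norm_sq
  have hmin : IsLocalMin (fun w => ‖y - g w‖ ^ 2) z := by
    refine Filter.Eventually.of_forall fun w => ?_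
    have := hp ((extChartAt (𝓡 d) p).symm w)
    rw [dist_eq_norm, dist_eq_norm] at this
    simp only [hgz]
    gcongr
  have h0 := hmin.hasFDerivAt_eq_zero hsq
  rw [Submodule.mem_orthogonal']
  rintro _ ⟨u, rfl⟩
  have hu := DFunLike.congr_fun h0 u
  rw [hgz] at hu
  have h2 : (2 : ℝ) * inner ℝ (y - (p : EuclideanSpace ℝ (Fin D))) (-A u) = 0 := by
    rw [two_mul, ← two_nsmul]
    exact hu
  rw [inner_neg_right] at h2
  have h3 : inner ℝ (y - (p : EuclideanSpace ℝ (Fin D))) (A u) = 0 := by linarith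
  exact h3

theorem normalBundleEmbedded_of_lt_conditionNumber {r : ℝ≥0}
    (hr : (r : ℝ≥0∞) < conditionNumber (d := d) M) : NormalBundleEmbedded (d := d) M r := by
  obtain ⟨τ, hτ, hrτ⟩ := lt_sSup_iff.mp hr
  exact hτ r hrτ

theorem exists_nearest_point (hMne : M.Nonempty) (hMclosed : IsClosed M)
    (y : EuclideanSpace ℝ (Fin D)) : ∃ p : M, ∀ q : M, dist y p ≤ dist y q := by
  obtain ⟨p, hpM, hp⟩ := hMclosed.exists_infDist_eq_dist hMne y
  exact ⟨⟨p, hpM⟩, fun q => hp ▸ Metric.infDist_le_dist_of_mem q.2⟩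

/-- Below the condition number, the foot point of a normal vector is nearest to its endpoint. -/
theorem IsSmoothSubmanifold.norm_le_dist_add_normal (hM : IsSmoothSubmanifold (d := d) M)
    (hMclosed : IsClosed M) {p : M} {v : EuclideanSpace ℝ (Fin D)}
    (hv : v ∈ (tangentSubspace (d := d) M p)ᗮ)
    (hlt : ENNReal.ofReal ‖v‖ < conditionNumber (d := d) M) (q : M) :
    ‖v‖ ≤ dist ((p : EuclideanSpace ℝ (Fin D)) + v) q := by
  obtain ⟨r, hvr, hr⟩ := ENNReal.lt_iff_exists_nnreal_btwn.mp hlt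
  have hvr : ‖v‖ < r := by
    rw [ENNReal.ofReal_lt_coe_iff (norm_nonneg v)] at hvr
    exact hvr
  obtain ⟨s, hs⟩ := exists_nearest_point ⟨p, p.2⟩ hMclosed ((p : EuclideanSpace ℝ (Fin D)) + v)
  have hsn := hM.sub_mem_orthogonal_tangentSubspace hs
  have hsp : ‖(p : EuclideanSpace ℝ (Fin D)) + v - s‖ ≤ ‖v‖ := by
    simpa [dist_eq_norm] using hs p
  -- `(p, v)` and `(s, p + v - s)` are both normal vectors shorter than `r` with the same endpoint,
  -- so injectivity forces `s = p`.
  have h := (normalBundleEmbedded_of_lt_conditionNumber hr).1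
    (show ((p, v) : M × EuclideanSpace ℝ (Fin D)) ∈ openNormalBundle (d := d) M r from ⟨hv, hvr⟩)
    (show ((s, (p : EuclideanSpace ℝ (Fin D)) + v - s) : M × EuclideanSpace ℝ (Fin D)) ∈
      openNormalBundle (d := d) M r from ⟨hsn, hsp.trans_lt hvr⟩)
    (by simp [endpointMap])
  have hps : p = s := congrArg Prod.fst h
  subst hps
  simpa [dist_eq_norm] using hs q

/-- Federer's estimate for the normal component of a chord. -/
theorem IsSmoothSubmanifold.two_mul_norm_starProjection_orthogonal_le
    (hM : IsSmoothSubmanifold (d := d) M) (hMclosed : IsClosed M) {τ : ℝ≥0}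
    (hτ : (τ : ℝ≥0∞) ≤ conditionNumber (d := d) M) (p x : M) :
    2 * τ * ‖(tangentSubspace (d := d) M p)ᗮ.starProjection
      ((x : EuclideanSpace ℝ (Fin D)) - p)‖ ≤ ‖(x : EuclideanSpace ℝ (Fin D)) - p‖ ^ 2 := by
  set T := tangentSubspace (d := d) M p
  set w : EuclideanSpace ℝ (Fin D) := (x : EuclideanSpace ℝ (Fin D)) - p with hw
  set v := Tᗮ.starProjection w with hvdef
  have hvT : v ∈ Tᗮ := Submodule.starProjection_apply_mem _ _
  rcases (norm_nonneg v).eq_or_lt with h0 | hvpos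
  · rw [← h0]; simp
  have hinner : inner ℝ w v = ‖v‖ ^ 2 := by
    have hsub : w - v ∈ (Tᗮ)ᗮ := Submodule.sub_starProjection_mem_orthogonal w
    have h1 : inner ℝ (w - v) v = 0 := Submodule.inner_left_of_mem_orthogonal hvT hsub
    rw [inner_sub_left, real_inner_self_eq_norm_sq] at h1
    linarith
  -- Rescale `v` to length `t` and expand `t² ≤ ‖w - (t/‖v‖) v‖²`. Strictness `t < τ` is needed for
  -- the embedding; the bound at `τ` follows by density.
  have key : ∀ t : ℝ, 0 ≤ t → t < τ → 2 * t * ‖v‖ ≤ ‖w‖ ^ 2 := by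
    intro t ht htτ
    have hnorm : ‖(t / ‖v‖) • v‖ = t := by
      rw [norm_smul, Real.norm_of_nonneg (by positivity)]
      field_simp
    have h := hM.norm_le_dist_add_normal hMclosed (Tᗮ.smul_mem (t / ‖v‖) hvT)
      (by
        rw [hnorm]
        refine lt_of_lt_of_le ?_ hτ
        rwa [ENNReal.ofReal_lt_coe_iff ht]) x
    rw [hnorm, dist_comm, dist_eq_norm, ← sub_sub, ← hw] at h
    have h2 : t ^ 2 ≤ ‖w - (t / ‖v‖) • v‖ ^ 2 := by gcongr
    rw [norm_sub_sq_real, hnorm, inner_smul_right, hinner] at h2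
    have h3 : t / ‖v‖ * ‖v‖ ^ 2 = t * ‖v‖ := by field_simp
    rw [h3] at h2
    linarith
  have hτ' : (τ : ℝ) ≤ ‖w‖ ^ 2 / (2 * ‖v‖) := by
    refine le_of_forall_lt_imp_le_of_dense fun t ht => ?_
    rcases le_total t 0 with ht0 | ht0
    · exact ht0.trans (by positivity)
    · rw [le_div_iff₀ (by positivity)]
      linarith [key t ht0 ht]
  rw [le_div_iff₀ (by positivity)] at hτ'
  linarith

end Submanifold

/-! ### Means, variances and adapted orthonormal bases -/

section Covariance

variable {D : ℕ}

theorem sum_sub_dataMean (A : Finset (EuclideanSpace ℝ (Fin D))) :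
    ∑ x ∈ A, (x - dataMean A) = 0 := by
  rcases A.eq_empty_or_nonempty with rfl | hA
  · simp
  have : (A.card : ℝ) ≠ 0 := by exact_mod_cast hA.card_pos.ne'
  rw [Finset.sum_sub_distrib, Finset.sum_const, ← Nat.cast_smul_eq_nsmul ℝ, dataMean,
    smul_smul, mul_inv_cancel₀ this, one_smul, sub_self]

/-- Steiner's identity for the image of a finite set under a linear map. -/
theorem sum_norm_sq_map_sub {F : Type*} [NormedAddCommGroup F] [InnerProductSpace ℝ F]
    (L : EuclideanSpace ℝ (Fin D) →L[ℝ] F) (A : Finset (EuclideanSpace ℝ (Fin D)))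
    (q : EuclideanSpace ℝ (Fin D)) :
    ∑ x ∈ A, ‖L (x - q)‖ ^ 2 =
      ∑ x ∈ A, ‖L (x - dataMean A)‖ ^ 2 + A.card * ‖L (dataMean A - q)‖ ^ 2 := by
  have h : ∀ x, ‖L (x - q)‖ ^ 2 = ‖L (x - dataMean A)‖ ^ 2 +
      2 * inner ℝ (L (x - dataMean A)) (L (dataMean A - q)) + ‖L (dataMean A - q)‖ ^ 2 := by
    intro x
    rw [← norm_add_sq_real, ← map_add, sub_add_sub_cancel]
  rw [Finset.sum_congr rfl fun x _ => h x]
  rw [Finset.sum_add_distrib, Finset.sum_add_distrib, ← Finset.mul_sum, ← sum_inner, ← map_sum,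
    sum_sub_dataMean]
  simp

theorem dataMean_map_linearIsometryEquiv
    (Φ : EuclideanSpace ℝ (Fin D) ≃ₗᵢ[ℝ] EuclideanSpace ℝ (Fin D))
    (A : Finset (EuclideanSpace ℝ (Fin D))) :
    dataMean (A.map Φ.toIsometryEquiv.toEquiv.toEmbedding) = Φ (dataMean A) := by
  simp only [dataMean, Finset.card_map, Finset.sum_map, map_smul, map_sum]
  rfl

theorem dataCovariance_map_orthonormalBasis_apply_self
    (b : OrthonormalBasis (Fin D) ℝ (EuclideanSpace ℝ (Fin D)))
    (A : Finset (EuclideanSpace ℝ (Fin D))) (i : Fin D) :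
    dataCovariance (A.map b.repr.toIsometryEquiv.toEquiv.toEmbedding) i i =
      (A.card : ℝ)⁻¹ * ∑ x ∈ A, inner ℝ (b i) (x - dataMean A) ^ 2 := by
  rw [dataCovariance, Matrix.of_apply, dataMean_map_linearIsometryEquiv]
  simp only [Finset.card_map, Finset.sum_map, ← OrthonormalBasis.repr_apply_apply, map_sub, pow_two]
  rfl

/-- A `d`-dimensional subspace is spanned by the part of an orthonormal basis of `ℝ^D` indexed by
some `d`-element set. -/
theorem exists_orthonormalBasis_sum_inner_sq_eq_starProjection
    (T : Submodule ℝ (EuclideanSpace ℝ (Fin D))) :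
    ∃ (b : OrthonormalBasis (Fin D) ℝ (EuclideanSpace ℝ (Fin D))) (J : Finset (Fin D)),
      J.card = Module.finrank ℝ T ∧
        ∀ w, ∑ i ∈ J, inner ℝ (b i) w ^ 2 = ‖T.starProjection w‖ ^ 2 := by
  have hle : Module.finrank ℝ T ≤ D := by simpa using T.finrank_le
  set e := stdOrthonormalBasis ℝ T
  -- The zero values are placeholders: orthonormality is needed only on the first `finrank ℝ T`
  -- indices, and the extension replaces the others.
  set v : Fin D → EuclideanSpace ℝ (Fin D) := fun i =>
    if h : (i : ℕ) < Module.finrank ℝ T then e ⟨i, h⟩ else 0 with hv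
  have hvs : Orthonormal ℝ (Set.domRestrict {i : Fin D | (i : ℕ) < Module.finrank ℝ T} v) := by
    have := (e.orthonormal.comp_linearIsometry T.subtypeₗᵢ).comp
      (fun i : {i : Fin D | (i : ℕ) < Module.finrank ℝ T} => ⟨(i : Fin D), i.2⟩)
      (fun i j hij => by simpa [Subtype.ext_iff, Fin.ext_iff] using hij)
    convert this using 1
    ext1 i
    have hi : ((i : Fin D) : ℕ) < Module.finrank ℝ T := i.2
    simp [Set.domRestrict, hv, hi]
  obtain ⟨b, hb⟩ := hvs.exists_orthonormalBasis_extension_of_card_eq (by simp)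
  refine ⟨b, Finset.univ.map (Fin.castLEEmb hle), by simp, fun w => ?_⟩
  rw [Finset.sum_map, Submodule.starProjection_apply, ← Submodule.coe_norm,
    ← e.sum_sq_norm_inner_right]
  refine Finset.sum_congr rfl fun i _ => ?_
  have hbi : b (Fin.castLEEmb hle i) = e i := by
    rw [hb _ (by simp)]
    simp [hv]
  rw [hbi, Real.norm_eq_abs, sq_abs, Submodule.coe_inner, ← Submodule.starProjection_apply,
    ← Submodule.inner_starProjection_left_eq_right,
    Submodule.starProjection_eq_self_iff.mpr (e i).2]

/-- In an orthonormal basis adapted to `T`, the diagonal covariance entries along `T` sum to the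
variance of the projection, and the trace is the total variance. -/
theorem HasCovarianceDimension.of_sum_norm_sq_starProjection_le
    {A : Finset (EuclideanSpace ℝ (Fin D))} {ε : ℝ} (T : Submodule ℝ (EuclideanSpace ℝ (Fin D)))
    (h : (1 - ε) * ∑ x ∈ A, ‖x - dataMean A‖ ^ 2 ≤
      ∑ x ∈ A, ‖T.starProjection (x - dataMean A)‖ ^ 2) :
    HasCovarianceDimension A (Module.finrank ℝ T) ε := by
  obtain ⟨b, J, hJ, hb⟩ := exists_orthonormalBasis_sum_inner_sq_eq_starProjection T
  refine ⟨b.repr.toIsometryEquiv, J, hJ, ?_⟩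
  simp only [Matrix.trace, Matrix.diag_apply, dataCovariance_map_orthonormalBasis_apply_self,
    ← Finset.mul_sum]
  rw [Finset.sum_comm, Finset.sum_comm (s := J)]
  simp only [hb]
  have hn : ∀ w, ∑ i, inner ℝ (b i) w ^ 2 = ‖w‖ ^ 2 := fun w => by
    rw [← b.sum_sq_norm_inner_right]
    simp
  simp only [hn]
  rw [mul_left_comm]
  gcongr

theorem dist_dataMean_le {A : Finset (EuclideanSpace ℝ (Fin D))} (hA : A.Nonempty)
    {c : EuclideanSpace ℝ (Fin D)} {r : ℝ} (h : ∀ x ∈ A, dist x c ≤ r) :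
    dist (dataMean A) c ≤ r := by
  have hmem : dataMean A ∈ Metric.closedBall c r := by
    have hc : (A.card : ℝ) ≠ 0 := by exact_mod_cast hA.card_pos.ne'
    rw [dataMean, Finset.smul_sum]
    exact (convex_closedBall c r).sum_mem (fun _ _ => by positivity) (by simp [hc]) h
  exact hmem

end Covariance

/-! ### The variance estimate -/

/-- The tangent space at a point nearest to the mean captures a `1 - ε` fraction of the variance of
a finite subset of a ball whose radius is small compared to the condition number. -/
theorem IsSmoothSubmanifold.sum_norm_sq_starProjection_tangentSubspace_ge {d D : ℕ}
    {M : Set (EuclideanSpace ℝ (Fin D))} [ChartedSpace (EuclideanSpace ℝ (Fin d)) M]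
    (hM : IsSmoothSubmanifold (d := d) M) (hMclosed : IsClosed M)
    {τ : ℝ≥0} (hτ : (τ : ℝ≥0∞) ≤ conditionNumber (d := d) M)
    {A : Finset (EuclideanSpace ℝ (Fin D))} (hA : A.Nonempty) (hAM : ∀ x ∈ A, x ∈ M)
    {ε : ℝ} (hε0 : 0 ≤ ε) {c : EuclideanSpace ℝ (Fin D)}
    (hAc : ∀ x ∈ A, dist x c ≤ √ε * τ / 3)
    {p : M} (hp : ∀ q : M, dist (dataMean A) p ≤ dist (dataMean A) q) :
    (1 - ε) * ∑ x ∈ A, ‖x - dataMean A‖ ^ 2 ≤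
      ∑ x ∈ A, ‖(tangentSubspace (d := d) M p).starProjection (x - dataMean A)‖ ^ 2 := by
  set T := tangentSubspace (d := d) M p
  set m := dataMean A with hm
  set r := √ε * τ / 3 with hr
  have hmc : dist m c ≤ r := dist_dataMean_le hA hAc
  have hxm : ∀ x ∈ A, dist x m ≤ 2 * r := fun x hx => by
    linarith [dist_triangle_right x m c, hAc x hx]
  have hmp : ∀ x ∈ A, dist m p ≤ dist x m := fun x hx => by
    simpa [dist_comm] using hp ⟨x, hAM x hx⟩
  have hxp : ∀ x ∈ A, ‖x - p‖ ≤ 4 * r := fun x hx => by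
    rw [← dist_eq_norm]
    linarith [dist_triangle x m p, hxm x hx, hmp x hx]
  have hr0 : 0 ≤ r := by positivity
  have hr2 : r ^ 2 = ε * τ ^ 2 / 9 := by
    rw [hr, div_pow, mul_pow, Real.sq_sqrt hε0]; norm_num
  suffices hN : ∑ x ∈ A, ‖Tᗮ.starProjection (x - m)‖ ^ 2 ≤ ε * ∑ x ∈ A, ‖x - m‖ ^ 2 by
    have : ∑ x ∈ A, ‖x - m‖ ^ 2 = ∑ x ∈ A, ‖T.starProjection (x - m)‖ ^ 2 +
        ∑ x ∈ A, ‖Tᗮ.starProjection (x - m)‖ ^ 2 := by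
      rw [← Finset.sum_add_distrib]
      exact Finset.sum_congr rfl fun x _ => T.norm_sq_eq_add_norm_sq_starProjection (x - m)
    linarith
  have hsum0 : 0 ≤ ∑ x ∈ A, ‖x - m‖ ^ 2 := by positivity
  -- For `τ = 0` Federer's estimate is vacuous, but the ball has radius `0` and every point equals
  -- the mean.
  rcases τ.2.eq_or_lt with hτ0 | hτpos
  · have hτ0 : (τ : ℝ) = 0 := hτ0.symm
    have hr0 : r = 0 := by simp [hr, hτ0]
    have hz : ∀ x ∈ A, x - m = 0 := fun x hx => by
      rw [sub_eq_zero, ← dist_le_zero]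
      simpa [hr0] using hxm x hx
    rw [Finset.sum_eq_zero fun x hx => by rw [hz x hx]; simp]
    positivity
  have hτpos : 0 < (τ : ℝ) := hτpos
  -- `(4r / (2τ))² = 4ε/9`.
  have hnormal : ∀ x ∈ A, ‖Tᗮ.starProjection (x - p)‖ ^ 2 ≤ 4 * ε / 9 * ‖x - p‖ ^ 2 := by
    intro x hx
    have h1 := hM.two_mul_norm_starProjection_orthogonal_le hMclosed hτ p ⟨x, hAM x hx⟩
    have h2 : (2 * τ * ‖Tᗮ.starProjection (x - p)‖) ^ 2 ≤ (4 * r * ‖x - p‖) ^ 2 := by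
      refine pow_le_pow_left₀ (by positivity) (h1.trans ?_) 2
      rw [sq]
      exact mul_le_mul_of_nonneg_right (hxp x hx) (norm_nonneg _)
    rw [mul_pow, mul_pow, mul_pow, mul_pow, hr2] at h2
    refine le_of_mul_le_mul_left (a := 4 * (τ : ℝ) ^ 2) ?_ (by positivity)
    linarith
  have hcard : A.card * ‖m - p‖ ^ 2 ≤ ∑ x ∈ A, ‖x - m‖ ^ 2 := by
    rw [← nsmul_eq_mul]
    refine Finset.card_nsmul_le_sum _ _ _ fun x hx => ?_
    have := hmp x hx
    rw [dist_eq_norm, dist_eq_norm] at this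
    gcongr
  have hsteiner := sum_norm_sq_map_sub (ContinuousLinearMap.id ℝ _) A (p : EuclideanSpace ℝ (Fin D))
  simp only [ContinuousLinearMap.id_apply, ← hm] at hsteiner
  calc ∑ x ∈ A, ‖Tᗮ.starProjection (x - m)‖ ^ 2
      ≤ ∑ x ∈ A, ‖Tᗮ.starProjection (x - p)‖ ^ 2 := by
        -- The second moment of the projected data is least about its own mean.
        rw [sum_norm_sq_map_sub Tᗮ.starProjection A (p : EuclideanSpace ℝ (Fin D)), ← hm]
        exact le_add_of_nonneg_right (by positivity)
    _ ≤ ∑ x ∈ A, 4 * ε / 9 * ‖x - p‖ ^ 2 := Finset.sum_le_sum hnormal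
    _ = 4 * ε / 9 * ∑ x ∈ A, ‖x - p‖ ^ 2 := by rw [Finset.mul_sum]
    _ ≤ 4 * ε / 9 * (2 * ∑ x ∈ A, ‖x - m‖ ^ 2) := by gcongr; linarith
    _ ≤ ε * ∑ x ∈ A, ‖x - m‖ ^ 2 := by nlinarith [mul_nonneg hε0 hsum0]

theorem theorem5 {d D : ℕ} (M : Set (EuclideanSpace ℝ (Fin D)))
    [ChartedSpace (EuclideanSpace ℝ (Fin d)) M]
    (hM : IsSmoothSubmanifold (d := d) M) (hMne : M.Nonempty) (hMclosed : IsClosed M)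
    (τ : ℝ≥0) (hτ : (τ : ℝ≥0∞) ≤ conditionNumber (d := d) M)
    (S : Finset (EuclideanSpace ℝ (Fin D))) (hS : ∀ x ∈ S, x ∈ M)
    (ε : ℝ) (hε0 : 0 ≤ ε) (hε : ε ≤ 1 / 4) :
    HasLocalCovarianceDimension S d ε (√ε * (τ : ℝ) / 3) ∧
      ∀ c : EuclideanSpace ℝ (Fin D), ∀ A : Finset (EuclideanSpace ℝ (Fin D)),
        A = restrictToBall S c (√ε * (τ : ℝ) / 3) → A.Nonempty →
          (∃ p : M, ∀ q : M, dist (dataMean A) p ≤ dist (dataMean A) q) ∧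
          ∀ p : M, (∀ q : M, dist (dataMean A) p ≤ dist (dataMean A) q) →
            Module.finrank ℝ (tangentSubspace (d := d) M p) = d ∧
            (1 - ε) * ∑ x ∈ A, ‖x - dataMean A‖ ^ 2 ≤
              ∑ x ∈ A, ‖(tangentSubspace (d := d) M p).starProjection (x - dataMean A)‖ ^ 2 := by
  have main : ∀ c : EuclideanSpace ℝ (Fin D), ∀ A : Finset (EuclideanSpace ℝ (Fin D)),
      A = restrictToBall S c (√ε * (τ : ℝ) / 3) → A.Nonempty →
        ∀ p : M, (∀ q : M, dist (dataMean A) p ≤ dist (dataMean A) q) →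
          (1 - ε) * ∑ x ∈ A, ‖x - dataMean A‖ ^ 2 ≤
            ∑ x ∈ A, ‖(tangentSubspace (d := d) M p).starProjection (x - dataMean A)‖ ^ 2 := by
    intro c A hAeq hA p hp
    have hmem : ∀ x ∈ A, x ∈ S ∧ dist x c ≤ √ε * (τ : ℝ) / 3 := fun x hx => by
      classical
      rw [hAeq] at hx
      simpa [restrictToBall] using hx
    exact hM.sum_norm_sq_starProjection_tangentSubspace_ge hMclosed hτ hA
      (fun x hx => hS x (hmem x hx).1) hε0 (fun x hx => (hmem x hx).2) hp
  refine ⟨fun c => ?_, fun c A hAeq hA => ⟨exists_nearest_point hMne hMclosed _,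
    fun p hp => ⟨hM.finrank_tangentSubspace p, main c A hAeq hA p hp⟩⟩⟩
  obtain ⟨p, hp⟩ := exists_nearest_point hMne hMclosed
    (dataMean (restrictToBall S c (√ε * (τ : ℝ) / 3)))
  rw [← hM.finrank_tangentSubspace p]
  refine .of_sum_norm_sq_starProjection_le _ ?_
  rcases (restrictToBall S c (√ε * (τ : ℝ) / 3)).eq_empty_or_nonempty with h | h
  · simp [h]
  · exact main c _ rfl h p hp
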